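/- Let $d \ge 1$ be an integer and let $(c_n)_{n\ge 1}$ be a sequence of positive real numbers such that for every permutation $(c'_n)$ of $(c_n)$ the sequence $(\sqrt[d]{n}/c'_n)_{n \ge 1}$ is unbounded. Then there exist a sequence $(b_n)_{n\ge 1}$ of positive real numbers and a continuous, nonnegative, Lebesgue integrable function $f:\mathbb{R}^d\to\mathbb{R}$ such that $b_n/c_n \to 1$ and, for every $x\in\mathbb{R}^d$, the sequence $(f(b_n x))$ does not converge to $0$. If moreover $c_n \to \infty$, then the same $(b_n)$ and $f$ can be chosen so that additionally $\limsup_{n\to\infty} f(b_n x)=\infty$ for every $x \in \mathbb{R}^d\setminus\{0\}$. -/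

import Mathlib

open Filter Topology MeasureTheory

/-! If `c` does not tend to infinity, `b = c` and a positive, radially decreasing integrable
function suffice. Otherwise the hypothesis says that the number of terms up to `t` is not `O(t ^
d)`, so for all `q > 1` and `K` there are arbitrarily large `T` whose window `(T, q T]` holds `M ≥ K
T ^ d` terms.

With `q = 1 + ε`, those terms may be replaced by `M` equally spaced points of `[T, q T)`, at a
relative cost of at most `ε`. For `‖x‖ ≤ R` their multiples of `‖x‖` have gaps at most `T δ`, where
`δ = ε R / M`. Hence, for every `x` with `1 / R ≤ ‖x‖ ≤ R`, some multiple falls in one of the shells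
of half-width `T δ` around the radii `T q ^ j / R`. The number of shells depends only on `ε` and
`R`, and each has volume `O(δ T ^ d) = O(1 / K)`, so bumps of any height `H` on them have small
integral once `K` is large. Summing over blocks with `ε → 0`, `R, H → ∞` and summable integrals
gives `f`. -/

/-! ### Counting terms and rich windows -/

theorem finite_setOf_le_of_tendsto {c : ℕ → ℝ} (hc : Tendsto c atTop atTop) (t : ℝ) :
    {m | c m ≤ t}.Finite := by
  have := hc.eventually_gt_atTop t
  rw [← Nat.cofinite_eq_atTop, eventually_cofinite] at this
  simpa using this

/-- A real sequence tending to infinity can be rearranged so that the term of index `n` dominates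
at least `n + 1` terms of the sequence. -/
theorem exists_perm_succ_le_ncard {c : ℕ → ℝ} (hc : Tendsto c atTop atTop) :
    ∃ σ : Equiv.Perm ℕ, ∀ n, n + 1 ≤ {m | c m ≤ c (σ n)}.ncard := by
  have hfin := finite_setOf_le_of_tendsto hc
  -- The index breaks ties between equal terms, which makes the rank `r` below injective.
  let key : ℕ → ℝ ×ₗ ℕ := fun n => toLex (c n, n)
  have hkey : Function.Injective key := fun a b h => by
    have := congrArg (fun p => (ofLex p).2) h
    simpa [key] using this
  have hle : ∀ m n, key m ≤ key n → c m ≤ c n := fun m n h => by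
    rcases Prod.Lex.toLex_le_toLex.1 h with h | h
    · exact h.le
    · exact h.1.le
  have hfinle : ∀ n, {m | key m ≤ key n}.Finite := fun n =>
    (hfin (c n)).subset fun m hm => hle m n hm
  have hfinlt : ∀ n, {m | key m < key n}.Finite := fun n =>
    (hfinle n).subset fun m hm => le_of_lt (show key m < key n from hm)
  let r : ℕ → ℕ := fun n => {m | key m < key n}.ncard
  have hr : ∀ m n, key m < key n → r m < r n := fun m n h => by
    refine Set.ncard_lt_ncard ?_ (hfinlt n)
    refine ⟨fun k hk => lt_trans hk h, fun hs => ?_⟩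
    exact lt_irrefl (key m) (hs (show m ∈ {k | key k < key n} from h))
  have hinj : Function.Injective r := fun m n h => by
    rcases lt_trichotomy (key m) (key n) with h' | h' | h'
    · exact absurd h (hr _ _ h').ne
    · exact hkey h'
    · exact absurd h (hr _ _ h').ne'
  have hcard : ∀ n, {m | key m ≤ key n}.ncard = r n + 1 := fun n => by
    have : {m | key m ≤ key n} = insert n {m | key m < key n} := by
      ext m
      simp only [Set.mem_ofPred_eq, Set.mem_insert_iff]
      rw [le_iff_eq_or_lt, hkey.eq_iff]
    rw [this, Set.ncard_insert_of_notMem (by simp) (hfinlt n)]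
  have hsurj : Function.Surjective r := fun k => by
    obtain ⟨n, hn⟩ : ∃ n, k ≤ r n := by
      by_contra! h
      exact (Set.infinite_of_injective_forall_mem hinj (s := Set.Iio k) h) (Set.finite_Iio k)
    have himg : r '' {m | key m ≤ key n} = Set.Iio (r n + 1) := by
      refine Set.eq_of_subset_of_ncard_le ?_ ?_ (Set.finite_Iio _)
      · rintro _ ⟨m, hm, rfl⟩
        rcases eq_or_lt_of_le (show key m ≤ key n from hm) with h | h
        · rw [hkey h]; exact Nat.lt_succ_self _
        · exact (hr _ _ h).trans (Nat.lt_succ_self _)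
      · rw [Set.ncard_image_of_injective _ hinj, hcard]
        simp
    have : k ∈ r '' {m | key m ≤ key n} := by
      rw [himg]; exact Nat.lt_succ_of_le hn
    obtain ⟨m, -, hm⟩ := this
    exact ⟨m, hm⟩
  refine ⟨(Equiv.ofBijective r ⟨hinj, hsurj⟩).symm, fun n => ?_⟩
  set s := (Equiv.ofBijective r ⟨hinj, hsurj⟩).symm n with hs
  have hrs : r s = n := (Equiv.ofBijective r ⟨hinj, hsurj⟩).apply_symm_apply n
  calc n + 1 = {m | key m ≤ key s}.ncard := by rw [hcard, hrs]
    _ ≤ _ := Set.ncard_le_ncard (fun m hm => hle m s hm) (hfin _)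

/-- If the number of terms in `(T, q T]` is at most `K T ^ d` for large `T`, then the number of terms
up to `t` is `O(t ^ d)`. -/
theorem ncard_le_of_window_le {c : ℕ → ℝ} (hc : Tendsto c atTop atTop) {d : ℕ} (hd : 0 < d)
    {q K T₀ : ℝ} (hq : 1 < q) (hT₀ : 0 < T₀)
    (h : ∀ T ≥ T₀, ({n | T < c n ∧ c n ≤ q * T}.ncard : ℝ) < K * T ^ d) :
    ∃ C > 0, ∀ t ≥ T₀, ({n | c n ≤ t}.ncard : ℝ) ≤ C * t ^ d := by
  have hfin := finite_setOf_le_of_tendsto hc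
  have hq0 : 0 < q := by linarith
  have hqd : q ≤ q ^ d := le_self_pow₀ hq.le hd.ne'
  have hqd1 : 0 < q ^ d - 1 := by linarith
  have hK : 0 < K := by
    by_contra! hK
    have h1 := h T₀ le_rfl
    have h2 : K * T₀ ^ d ≤ 0 := mul_nonpos_of_nonpos_of_nonneg hK (by positivity)
    have h3 : (0 : ℝ) ≤ ({n | T₀ < c n ∧ c n ≤ q * T₀}.ncard : ℝ) := by positivity
    linarith
  -- The first summand settles the base case, the second the induction step, which needs `K ≤ C * (q
  -- ^ d - 1)`.
  set C : ℝ := ({n | c n ≤ T₀}.ncard : ℝ) / T₀ ^ d + K / (q ^ d - 1) with hC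
  have hCpos : 0 < C := by positivity
  have hCK : K ≤ C * (q ^ d - 1) := by
    rw [hC, add_mul, div_mul_cancel₀ _ hqd1.ne']
    have : 0 ≤ ({n | c n ≤ T₀}.ncard : ℝ) / T₀ ^ d * (q ^ d - 1) := by positivity
    linarith
  have hpow : ∀ m : ℕ, ({n | c n ≤ q ^ m * T₀}.ncard : ℝ) ≤ C * (q ^ m * T₀) ^ d := by
    intro m
    induction m with
    | zero =>
      simp only [pow_zero, one_mul]
      rw [hC, add_mul, div_mul_cancel₀ _ (by positivity)]
      have : 0 ≤ K / (q ^ d - 1) * T₀ ^ d := by positivity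
      linarith
    | succ m ih =>
      have hT : T₀ ≤ q ^ m * T₀ := le_mul_of_one_le_left hT₀.le (one_le_pow₀ hq.le)
      have hw := h _ hT
      have hsub : {n | c n ≤ q ^ (m + 1) * T₀} ⊆
          {n | c n ≤ q ^ m * T₀} ∪ {n | q ^ m * T₀ < c n ∧ c n ≤ q * (q ^ m * T₀)} := by
        intro n hn
        rcases le_or_gt (c n) (q ^ m * T₀) with h' | h'
        · exact Or.inl h'
        · refine Or.inr ⟨h', ?_⟩
          have : c n ≤ q ^ (m + 1) * T₀ := hn
          rwa [pow_succ', mul_assoc] at this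
      have hle := (Set.ncard_le_ncard hsub ((hfin _).union ((hfin _).subset fun n hn => hn.2))).trans
        (Set.ncard_union_le _ _)
      have hle' : ({n | c n ≤ q ^ (m + 1) * T₀}.ncard : ℝ) ≤ ({n | c n ≤ q ^ m * T₀}.ncard : ℝ) +
          ({n | q ^ m * T₀ < c n ∧ c n ≤ q * (q ^ m * T₀)}.ncard : ℝ) := by exact_mod_cast hle
      have hp : 0 ≤ (q ^ m * T₀) ^ d := by positivity
      calc _ ≤ C * (q ^ m * T₀) ^ d + K * (q ^ m * T₀) ^ d := by linarith
        _ ≤ C * (q ^ m * T₀) ^ d + C * (q ^ d - 1) * (q ^ m * T₀) ^ d := by gcongr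
        _ = C * (q ^ (m + 1) * T₀) ^ d := by rw [pow_succ', mul_assoc q, mul_pow q]; ring
  refine ⟨C * q ^ d, by positivity, fun t ht => ?_⟩
  obtain ⟨m, hm1, hm2⟩ := exists_nat_pow_near ((one_le_div hT₀).2 ht) hq
  rw [le_div_iff₀ hT₀] at hm1
  rw [div_lt_iff₀ hT₀] at hm2
  calc ({n | c n ≤ t}.ncard : ℝ) ≤ ({n | c n ≤ q ^ (m + 1) * T₀}.ncard : ℝ) := by
        exact_mod_cast Set.ncard_le_ncard (fun n hn => le_trans hn hm2.le) (hfin _)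
    _ ≤ C * (q ^ (m + 1) * T₀) ^ d := hpow _
    _ = C * q ^ d * (q ^ m * T₀) ^ d := by rw [pow_succ', mul_assoc q, mul_pow q]; ring
    _ ≤ C * q ^ d * t ^ d := by gcongr

/-- If no rearrangement of `c` makes `n ^ (1 / d) / c n` bounded, some windows `(T, q T]` contain
many terms of `c`. -/
theorem exists_window {c : ℕ → ℝ} (hc : Tendsto c atTop atTop) (hpos : ∀ n, 0 < c n)
    {d : ℕ} (hd : 0 < d)
    (hperm : ∀ σ : Equiv.Perm ℕ,
      ¬ BddAbove (Set.range fun n : ℕ => ((n : ℝ) + 1) ^ (1 / (d : ℝ)) / c (σ n)))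
    {q : ℝ} (hq : 1 < q) (K : ℝ) {T₀ : ℝ} (hT₀ : 0 < T₀) :
    ∃ T ≥ T₀, K * T ^ d ≤ ({n | T < c n ∧ c n ≤ q * T}.ncard : ℝ) := by
  by_contra! h
  obtain ⟨C, hC, hCle⟩ := ncard_le_of_window_le hc hd hq hT₀ h
  obtain ⟨σ, hσ⟩ := exists_perm_succ_le_ncard hc
  obtain ⟨m₀, hm₀, hm₀le⟩ : ∃ m₀ > 0, ∀ n, m₀ ≤ c n := by
    obtain ⟨i, hi⟩ := (Nat.cofinite_eq_atTop ▸ hc : Tendsto c cofinite atTop).exists_forall_le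
    exact ⟨c i, hpos i, hi⟩
  have hfin := finite_setOf_le_of_tendsto hc
  -- The factor `1 + T₀ / m₀` lifts every term above `T₀`, where the counting bound applies.
  refine hperm σ ⟨C ^ (1 / (d : ℝ)) * (1 + T₀ / m₀), ?_⟩
  rintro _ ⟨n, rfl⟩
  set t := c (σ n) with ht
  have htpos : 0 < t := hpos _
  have hB : T₀ ≤ (1 + T₀ / m₀) * t := by
    have : T₀ / m₀ * m₀ ≤ T₀ / m₀ * t := by gcongr; exact hm₀le _
    rw [div_mul_cancel₀ _ hm₀.ne'] at this
    linarith
  have hB' : t ≤ (1 + T₀ / m₀) * t := by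
    have : 0 ≤ T₀ / m₀ * t := by positivity
    linarith
  have h1 : ((n : ℝ) + 1) ≤ C * ((1 + T₀ / m₀) * t) ^ d := by
    calc ((n : ℝ) + 1) ≤ ({m | c m ≤ t}.ncard : ℝ) := by exact_mod_cast hσ n
      _ ≤ ({m | c m ≤ (1 + T₀ / m₀) * t}.ncard : ℝ) := by
        exact_mod_cast Set.ncard_le_ncard (fun n hn => le_trans hn hB') (hfin _)
      _ ≤ _ := hCle _ hB
  rw [div_le_iff₀ htpos]
  calc ((n : ℝ) + 1) ^ (1 / (d : ℝ)) ≤ (C * ((1 + T₀ / m₀) * t) ^ d) ^ (1 / (d : ℝ)) := by gcongr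
    _ = C ^ (1 / (d : ℝ)) * ((1 + T₀ / m₀) * t) := by
      rw [Real.mul_rpow hC.le (by positivity), one_div,
        Real.pow_rpow_inv_natCast (by positivity) hd.ne']
    _ = _ := by ring

/-! ### Spherical shells and radial bumps -/

theorem pow_sub_pow_le_mul {a b : ℝ} (hb : 0 ≤ b) (hab : b ≤ a) (d : ℕ) :
    a ^ d - b ^ d ≤ d * a ^ (d - 1) * (a - b) := by
  have h := abs_pow_sub_pow_le a b d
  rw [abs_of_nonneg (sub_nonneg.2 hab), abs_of_nonneg (hb.trans hab), abs_of_nonneg hb,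
    max_eq_left hab] at h
  calc a ^ d - b ^ d ≤ _ := (le_abs_self _).trans h
    _ = _ := by ring

/-- The volume of a spherical shell is at most linear in its thickness. -/
theorem exists_volume_shell_le {d : ℕ} (hd : 0 < d) {P : ℝ} (hP : 0 ≤ P) :
    ∃ C ≥ 0, ∀ ρ δ T : ℝ, ρ ≤ P → 0 ≤ δ → δ ≤ 1 → 2 * δ ≤ ρ → 0 < T →
      volume {y : EuclideanSpace ℝ (Fin d) | |‖y‖ / T - ρ| ≤ 2 * δ} ≤
        ENNReal.ofReal (C * δ * T ^ d) := by
  have : Nonempty (Fin d) := ⟨⟨0, hd⟩⟩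
  set V := (volume (Metric.ball (0 : EuclideanSpace ℝ (Fin d)) 1)).toReal with hV
  have hVeq : volume (Metric.ball (0 : EuclideanSpace ℝ (Fin d)) 1) = ENNReal.ofReal V :=
    (ENNReal.ofReal_toReal measure_ball_lt_top.ne).symm
  have hV0 : 0 ≤ V := ENNReal.toReal_nonneg
  refine ⟨d * (P + 2) ^ (d - 1) * 4 * V, by positivity, fun ρ δ T hρ hδ hδ1 hδρ hT => ?_⟩
  have hr1 : 0 ≤ T * (ρ - 2 * δ) := mul_nonneg hT.le (by linarith)
  have hr2 : 0 ≤ T * (ρ + 2 * δ) := mul_nonneg hT.le (by linarith)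
  have hsub : {y : EuclideanSpace ℝ (Fin d) | |‖y‖ / T - ρ| ≤ 2 * δ} ⊆
      Metric.closedBall 0 (T * (ρ + 2 * δ)) \ Metric.ball 0 (T * (ρ - 2 * δ)) := by
    intro y hy
    rw [Set.mem_ofPred_eq, abs_le] at hy
    have h1 : ‖y‖ / T ≤ ρ + 2 * δ := by linarith [hy.2]
    have h2 : ρ - 2 * δ ≤ ‖y‖ / T := by linarith [hy.1]
    rw [div_le_iff₀' hT] at h1
    rw [le_div_iff₀' hT] at h2
    simp only [Set.mem_sdiff, Metric.mem_closedBall, dist_zero_right, Metric.mem_ball, not_lt]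
    exact ⟨h1, h2⟩
  refine (measure_mono hsub).trans ?_
  rw [measure_sdiff (Metric.ball_subset_closedBall.trans (Metric.closedBall_subset_closedBall
    (mul_le_mul_of_nonneg_left (by linarith) hT.le))) measurableSet_ball.nullMeasurableSet
    measure_ball_lt_top.ne, Measure.addHaar_closedBall _ _ hr2, Measure.addHaar_ball _ _ hr1, hVeq,
    finrank_euclideanSpace, Fintype.card_fin, ← ENNReal.ofReal_mul (by positivity),
    ← ENNReal.ofReal_mul (by positivity), ← ENNReal.ofReal_sub _ (by positivity)]
  apply ENNReal.ofReal_le_ofReal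
  have h := pow_sub_pow_le_mul (a := ρ + 2 * δ) (b := ρ - 2 * δ) (by linarith) (by linarith) d
  have h' : (ρ + 2 * δ) ^ (d - 1) ≤ (P + 2) ^ (d - 1) :=
    pow_le_pow_left₀ (by linarith) (by linarith) _
  have h'' : (ρ + 2 * δ) ^ d - (ρ - 2 * δ) ^ d ≤ d * (P + 2) ^ (d - 1) * (4 * δ) := by
    refine h.trans ?_
    rw [show ρ + 2 * δ - (ρ - 2 * δ) = 4 * δ by ring]
    gcongr
  calc (T * (ρ + 2 * δ)) ^ d * V - (T * (ρ - 2 * δ)) ^ d * V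
      = T ^ d * V * ((ρ + 2 * δ) ^ d - (ρ - 2 * δ) ^ d) := by rw [mul_pow, mul_pow]; ring
    _ ≤ T ^ d * V * (d * (P + 2) ^ (d - 1) * (4 * δ)) := by gcongr
    _ = _ := by ring

/-- A radial bump around the sphere of radius `T * ρ`. -/
noncomputable def shellBump {d : ℕ} (T δ ρ : ℝ) (y : EuclideanSpace ℝ (Fin d)) : ℝ :=
  max 0 (2 - |‖y‖ / T - ρ| / δ)

theorem continuous_shellBump {d : ℕ} (T δ ρ : ℝ) :
    Continuous (shellBump T δ ρ : EuclideanSpace ℝ (Fin d) → ℝ) := by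
  unfold shellBump
  fun_prop

theorem shellBump_nonneg {d : ℕ} (T δ ρ : ℝ) (y : EuclideanSpace ℝ (Fin d)) :
    0 ≤ shellBump T δ ρ y := le_max_left _ _

theorem shellBump_eq_zero {d : ℕ} {T δ ρ : ℝ} (hδ : 0 < δ) {y : EuclideanSpace ℝ (Fin d)}
    (h : 2 * δ ≤ |‖y‖ / T - ρ|) : shellBump T δ ρ y = 0 := by
  rw [shellBump, max_eq_left]
  rw [sub_nonpos, le_div_iff₀ hδ]
  exact h

theorem one_le_shellBump {d : ℕ} {T δ ρ : ℝ} (hδ : 0 < δ) {y : EuclideanSpace ℝ (Fin d)}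
    (h : |‖y‖ / T - ρ| ≤ δ) : 1 ≤ shellBump T δ ρ y := by
  refine le_max_of_le_right ?_
  have := (div_le_one hδ).2 h
  linarith

theorem lintegral_shellBump_le {d : ℕ} {T δ ρ : ℝ} (hδ : 0 < δ) :
    ∫⁻ y : EuclideanSpace ℝ (Fin d), ENNReal.ofReal (shellBump T δ ρ y) ≤
      2 * volume {y : EuclideanSpace ℝ (Fin d) | |‖y‖ / T - ρ| ≤ 2 * δ} := by
  have hm : MeasurableSet {y : EuclideanSpace ℝ (Fin d) | |‖y‖ / T - ρ| ≤ 2 * δ} :=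
    (isClosed_le (by fun_prop) continuous_const).measurableSet
  rw [← lintegral_indicator_const hm]
  refine lintegral_mono fun y => ?_
  by_cases hy : |‖y‖ / T - ρ| ≤ 2 * δ
  · rw [Set.indicator_of_mem (by exact hy)]
    have : shellBump T δ ρ y ≤ 2 :=
      max_le (by norm_num) (by have : 0 ≤ |‖y‖ / T - ρ| / δ := by positivity
                               linarith)
    simpa using ENNReal.ofReal_le_ofReal this
  · rw [shellBump_eq_zero hδ (not_le.1 hy).le]
    simp

/-! ### Construction of a single block -/

/-- Every `r` in `[1 / R, R]` is followed by a point `q ^ j / R` within ratio `q`. -/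
theorem exists_pow_div_mem {q R r : ℝ} (hq : 1 < q) (hR : 0 < R) (hr : 1 / R ≤ r) {J : ℕ}
    (hJ : r * R ≤ q ^ J) : ∃ j ≤ J, r ≤ q ^ j / R ∧ q ^ j / R < q * r := by
  classical
  have hex : ∃ j, r * R ≤ q ^ j := ⟨J, hJ⟩
  have hr1 : 1 ≤ r * R := (div_le_iff₀ hR).1 hr
  refine ⟨Nat.find hex, Nat.find_min' hex hJ, (le_div_iff₀ hR).2 (Nat.find_spec hex), ?_⟩
  rw [div_lt_iff₀ hR]
  rcases Nat.eq_zero_or_pos (Nat.find hex) with h | h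
  · rw [h, pow_zero]
    nlinarith
  · have h1 := Nat.find_min hex (Nat.sub_lt h one_pos)
    rw [not_le] at h1
    calc q ^ Nat.find hex = q * q ^ (Nat.find hex - 1) := by
          rw [← pow_succ', Nat.sub_add_cancel h]
      _ < q * (r * R) := by gcongr
      _ = q * r * R := by ring

/-- Used to distribute the equally spaced points over the indices of a window; their order is
irrelevant. -/
theorem exists_index_surj {ι α : Type*} [Inhabited α] (W : Finset ι) (a : ℕ → α) :
    ∃ β : ι → α, (∀ n ∈ W, ∃ k < W.card, β n = a k) ∧ ∀ k < W.card, ∃ n ∈ W, β n = a k := by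
  classical
  refine ⟨fun n => if h : n ∈ W then a (W.equivFin ⟨n, h⟩) else default, fun n hn =>
    ⟨_, (W.equivFin ⟨n, hn⟩).2, dif_pos hn⟩, fun k hk => ?_⟩
  obtain ⟨⟨n, hn⟩, hni⟩ := W.equivFin.surjective ⟨k, hk⟩
  exact ⟨n, hn, by simp only [dif_pos hn, hni]⟩

/-- One finite set of terms of `c` can be perturbed by a factor close to `1` so that the products
with every point of an annulus hit a bump of small integral, supported far from the origin. -/
theorem exists_perturbation_and_bump {c : ℕ → ℝ} (hc : Tendsto c atTop atTop) {d : ℕ} (hd : 0 < d)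
    (hwin : ∀ q > 1, ∀ K, ∀ T₀ > 0, ∃ T ≥ T₀,
      K * T ^ d ≤ ({n | T < c n ∧ c n ≤ q * T}.ncard : ℝ))
    {ε R H η S : ℝ} (hε : 0 < ε) (hR : 0 < R) (hH : 0 < H) (hη : 0 < η) (N : ℕ) :
    ∃ (W : Finset ℕ) (β : ℕ → ℝ) (g : EuclideanSpace ℝ (Fin d) → ℝ),
      (∀ n ∈ W, N ≤ n ∧ 0 < β n ∧ |β n / c n - 1| ≤ ε) ∧ Continuous g ∧ (∀ y, 0 ≤ g y) ∧
      (∀ y, ‖y‖ < S → g y = 0) ∧ ∫⁻ y, ENNReal.ofReal (g y) ≤ ENNReal.ofReal η ∧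
      ∀ x, 1 / R ≤ ‖x‖ → ‖x‖ ≤ R → ∃ n ∈ W, H ≤ g (β n • x) := by
  classical
  have hq : 1 < 1 + ε := by linarith
  obtain ⟨J, hJ⟩ := pow_unbounded_of_one_lt (R * R) hq
  obtain ⟨C, hC0, hC⟩ := exists_volume_shell_le hd (P := (1 + ε) ^ J / R) (by positivity)
  obtain ⟨B, hB⟩ : ∃ B, ∀ n < N, c n ≤ B := by
    obtain ⟨B, hB⟩ := ((Set.finite_Iio N).image c).bddAbove
    exact ⟨B, fun n hn => hB ⟨n, hn, rfl⟩⟩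
  -- Since `K * δ * T ^ d ≤ ε * R`, the three summands force `2 * δ ≤ 1 / (2 * R)`, `δ ≤ 1` and
  -- total integral at most `η`, respectively.
  set K : ℝ := 4 * R ^ 2 * ε + ε * R + (J + 1) * (2 * H * C * ε * R) / η with hK
  have hK0 : 0 < K := by positivity
  -- `T ≥ 1` gives `δ ≤ δ * T ^ d`, `T ≥ B` excludes indices below `N`, and `T ≥ 2 * R * S` keeps
  -- the bumps off the ball of radius `S`.
  obtain ⟨T, hT, hcard⟩ := hwin (1 + ε) hq K (max (max 1 B) (2 * R * S)) (by positivity)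
  have hT1 : 1 ≤ T := (le_max_left _ _).trans ((le_max_left _ _).trans hT)
  have hTB : B ≤ T := (le_max_right _ _).trans ((le_max_left _ _).trans hT)
  have hTS : 2 * R * S ≤ T := (le_max_right _ _).trans hT
  have hT0 : 0 < T := by linarith
  have hfin : {n | T < c n ∧ c n ≤ (1 + ε) * T}.Finite :=
    (finite_setOf_le_of_tendsto hc _).subset fun n hn => hn.2
  set W := hfin.toFinset with hW
  have hWmem : ∀ n, n ∈ W ↔ T < c n ∧ c n ≤ (1 + ε) * T := fun n => by simp [hW]
  rw [Set.ncard_eq_toFinset_card _ hfin, ← hW] at hcard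
  set M : ℝ := (W.card : ℝ) with hM
  have hM0 : 0 < M := lt_of_lt_of_le (by positivity) hcard
  set δ : ℝ := ε * R / M with hδ
  have hδ0 : 0 < δ := by positivity
  have hKδ : K * (δ * T ^ d) ≤ ε * R := by
    calc K * (δ * T ^ d) = K * T ^ d * δ := by ring
      _ ≤ M * δ := by gcongr
      _ = ε * R := by rw [hδ]; field_simp
  have hKδ' : K * δ ≤ ε * R := by
    refine le_trans ?_ hKδ
    have : δ ≤ δ * T ^ d := le_mul_of_one_le_right hδ0.le (one_le_pow₀ hT1)
    gcongr
  have hthird : 0 ≤ (J + 1) * (2 * H * C * ε * R) / η := by positivity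
  have hδ1 : δ ≤ 1 := by
    have : ε * R * δ ≤ K * δ := by
      gcongr; rw [hK]; nlinarith [mul_pos (pow_pos hR 2) hε]
    have h2 : ε * R * δ ≤ ε * R * 1 := by linarith
    exact le_of_mul_le_mul_left h2 (by positivity)
  have hδR : 2 * δ ≤ 1 / (2 * R) := by
    have : 4 * R ^ 2 * ε * δ ≤ K * δ := by
      gcongr; rw [hK]; nlinarith [mul_pos hε hR]
    have h2 : ε * R * (4 * R * δ) ≤ ε * R * 1 := by linarith
    have h3 := le_of_mul_le_mul_left h2 (by positivity)
    rw [le_div_iff₀ (by positivity)]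
    linarith
  have hδη : (J + 1) * (2 * H * (C * δ * T ^ d)) ≤ η := by
    have : (J + 1) * (2 * H * C * ε * R) / η * (δ * T ^ d) ≤ K * (δ * T ^ d) := by
      gcongr; rw [hK]; nlinarith [mul_pos hε hR, mul_pos (pow_pos hR 2) hε]
    have h1 := this.trans hKδ
    rw [div_mul_eq_mul_div, div_le_iff₀ hη] at h1
    have h2 : ε * R * ((J + 1) * (2 * H * (C * δ * T ^ d))) ≤ ε * R * η := by linarith
    exact le_of_mul_le_mul_left h2 (by positivity)
  have hρ1 : ∀ j : ℕ, 1 / R ≤ (1 + ε) ^ j / R := fun j => by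
    gcongr; exact one_le_pow₀ hq.le
  have hRR : 1 / (2 * R) + 1 / (2 * R) = 1 / R := by field_simp; norm_num
  obtain ⟨β, hβW, hβsurj⟩ := exists_index_surj W fun k : ℕ => T * (1 + ε * k / M)
  let g : EuclideanSpace ℝ (Fin d) → ℝ := fun y =>
    ∑ j ∈ Finset.range (J + 1), H * shellBump T δ ((1 + ε) ^ j / R) y
  have hg0 : ∀ j y, 0 ≤ H * shellBump T δ ((1 + ε) ^ j / R) (y : EuclideanSpace ℝ (Fin d)) :=
    fun j y => mul_nonneg hH.le (shellBump_nonneg _ _ _ _)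
  refine ⟨W, β, g, fun n hn => ?_, ?_, ?_, ?_, ?_, ?_⟩
  · obtain ⟨i, hiM, hβ⟩ := hβW n hn
    have hi : (i : ℝ) ≤ M := by rw [hM]; exact_mod_cast hiM.le
    have hi' : ε * i / M ≤ ε := by
      rw [div_le_iff₀ hM0]; gcongr
    have hi0 : 0 ≤ ε * i / M := by positivity
    obtain ⟨h1, h2⟩ := (hWmem n).1 hn
    have hc0 : 0 < c n := hT0.trans h1
    refine ⟨?_, ?_, ?_⟩
    · by_contra! hlt
      linarith [hB n hlt]
    · rw [hβ]; positivity
    · have hb1 : T ≤ β n := by rw [hβ]; exact le_mul_of_one_le_right hT0.le (by linarith)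
      have hb2 : β n ≤ T * (1 + ε) := by rw [hβ]; gcongr
      rw [div_sub_one hc0.ne', abs_div, abs_of_pos hc0, div_le_iff₀ hc0, abs_le]
      have hTc : ε * T ≤ ε * c n := by gcongr
      constructor <;> linarith
  · exact continuous_finsetSum _ fun j _ => (continuous_shellBump _ _ _).const_mul H
  · exact fun y => Finset.sum_nonneg fun j _ => hg0 j y
  · intro y hy
    refine Finset.sum_eq_zero fun j _ => ?_
    rw [shellBump_eq_zero hδ0, mul_zero]
    have hy' : ‖y‖ / T ≤ 1 / (2 * R) := by
      rw [div_le_div_iff₀ hT0 (by positivity)]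
      have : 2 * R * ‖y‖ ≤ 2 * R * S := by gcongr
      linarith
    rw [abs_sub_comm]
    refine le_trans ?_ (le_abs_self _)
    linarith [hρ1 j]
  · have hj : ∀ j ∈ Finset.range (J + 1), ∫⁻ y : EuclideanSpace ℝ (Fin d),
        ENNReal.ofReal (H * shellBump T δ ((1 + ε) ^ j / R) y) ≤
          ENNReal.ofReal (2 * H * (C * δ * T ^ d)) := by
      intro j hj
      simp_rw [ENNReal.ofReal_mul hH.le]
      rw [lintegral_const_mul _ (continuous_shellBump _ _ _).measurable.ennreal_ofReal,
        mul_comm 2 H, mul_assoc, ENNReal.ofReal_mul hH.le, ENNReal.ofReal_mul zero_le_two]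
      gcongr
      refine (lintegral_shellBump_le hδ0).trans ?_
      rw [ENNReal.ofReal_ofNat]
      gcongr
      refine hC _ _ _ ?_ hδ0.le hδ1 ?_ hT0
      · gcongr
        · exact hq.le
        · exact Nat.lt_succ_iff.1 (Finset.mem_range.1 hj)
      · have : 0 < 1 / (2 * R) := by positivity
        linarith [hρ1 j]
    simp only [g]
    simp_rw [ENNReal.ofReal_sum_of_nonneg fun j _ => hg0 j _]
    rw [lintegral_finsetSum _ fun j _ =>
      ((continuous_shellBump _ _ _).measurable.const_mul H).ennreal_ofReal]
    refine (Finset.sum_le_card_nsmul _ _ _ hj).trans ?_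
    rw [Finset.card_range, nsmul_eq_mul, ← ENNReal.ofReal_natCast,
      ← ENNReal.ofReal_mul (by positivity)]
    apply ENNReal.ofReal_le_ofReal
    push_cast
    exact hδη
  · intro x hx1 hx2
    set r := ‖x‖ with hr
    have hr0 : 0 < r := lt_of_lt_of_le (by positivity) hx1
    obtain ⟨j, hjJ, hj1, hj2⟩ := exists_pow_div_mem hq hR hx1 (J := J)
      (le_trans (by gcongr) hJ.le)
    set ρ := (1 + ε) ^ j / R
    -- The real solution of `r * (1 + ε * s / M) = ρ`; rounding down to an integer costs at most `r
    -- * ε / M ≤ δ`.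
    set s : ℝ := (ρ / r - 1) * M / ε with hs
    have hs0 : 0 ≤ s := by
      have : 1 ≤ ρ / r := (one_le_div hr0).2 hj1
      have : 0 ≤ ρ / r - 1 := by linarith
      positivity
    have hsM : s < M := by
      have : ρ / r < 1 + ε := (div_lt_iff₀ hr0).2 hj2
      rw [hs, div_lt_iff₀ hε, mul_comm M]
      gcongr
      linarith
    have hfl : ⌊s⌋₊ < W.card := (Nat.floor_lt hs0).2 hsM
    obtain ⟨n, hn, hβ⟩ := hβsurj _ hfl
    refine ⟨n, hn, ?_⟩
    have hβ0 : 0 ≤ β n := by rw [hβ]; positivity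
    have hρs : ρ = r * (1 + ε * s / M) := by rw [hs]; field_simp; ring
    have hbump : 1 ≤ shellBump T δ ρ (β n • x) := by
      apply one_le_shellBump hδ0
      rw [norm_smul, Real.norm_of_nonneg hβ0, ← hr, hβ,
        show T * (1 + ε * (⌊s⌋₊ : ℝ) / M) * r / T - ρ = - (r * ε / M * (s - ⌊s⌋₊)) by
          rw [mul_assoc, mul_div_cancel_left₀ _ hT0.ne', hρs]; ring, abs_neg, abs_of_nonneg
          (mul_nonneg (div_pos (mul_pos hr0 hε) hM0).le (sub_nonneg.2 (Nat.floor_le hs0)))]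
      have : s - ⌊s⌋₊ ≤ 1 := sub_le_iff_le_add'.2 (Nat.lt_floor_add_one s).le
      calc r * ε / M * (s - ⌊s⌋₊) ≤ R * ε / M * 1 := mul_le_mul
            (div_le_div_of_nonneg_right (mul_le_mul_of_nonneg_right hx2 hε.le) hM0.le) this
            (sub_nonneg.2 (Nat.floor_le hs0)) (div_pos (mul_pos hR hε) hM0).le
        _ = δ := by rw [mul_one, mul_comm R]
    calc H = H * 1 := (mul_one H).symm
      _ ≤ H * shellBump T δ ρ (β n • x) := mul_le_mul_of_nonneg_left hbump hH.le
      _ ≤ g (β n • x) := Finset.single_le_sum (f := fun j =>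
          H * shellBump T δ ((1 + ε) ^ j / R) (β n • x)) (fun j _ => hg0 j _)
          (Finset.mem_range.2 (Nat.lt_succ_of_le hjJ))

/-! ### Positive background function, summation and gluing -/

theorem integrable_one_add_norm_rpow_euclidean (d : ℕ) :
    Integrable fun x : EuclideanSpace ℝ (Fin d) => (1 + ‖x‖) ^ (-((d : ℝ) + 1)) :=
  integrable_one_add_norm (by simp)

theorem continuous_one_add_norm_rpow {E : Type*} [SeminormedAddCommGroup E] (r : ℝ) :
    Continuous fun x : E => (1 + ‖x‖) ^ r :=
  (continuous_const.add continuous_norm).rpow_const fun x =>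
    Or.inl (add_pos_of_pos_of_nonneg one_pos (norm_nonneg x)).ne'

/-- Infinitely many `c n` lie below some fixed `B`, and there the function is at least `(1 + B *
‖x‖) ^ (-r)`. -/
theorem not_tendsto_of_not_tendsto_atTop {E : Type*} [SeminormedAddCommGroup E] [NormedSpace ℝ E]
    {c : ℕ → ℝ} (hpos : ∀ n, 0 < c n) (hc : ¬ Tendsto c atTop atTop) {r : ℝ} (hr : 0 ≤ r) (x : E) :
    ¬ Tendsto (fun n => (1 + ‖c n • x‖) ^ (-r)) atTop (𝓝 0) := by
  intro h
  rw [tendsto_atTop] at hc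
  push Not at hc
  obtain ⟨B, hB⟩ := hc
  obtain ⟨n₀, hn₀⟩ := hB.exists
  have hB0 : 0 < B := (hpos n₀).trans hn₀
  have hlt : 0 < (1 + B * ‖x‖) ^ (-r) := by positivity
  obtain ⟨n, hn1, hn2⟩ := (hB.and_eventually (h.eventually (gt_mem_nhds hlt))).exists
  refine absurd hn2 (not_lt.2 ?_)
  have hle : 1 + ‖c n • x‖ ≤ 1 + B * ‖x‖ := by
    rw [norm_smul, Real.norm_of_nonneg (hpos n).le]
    gcongr
  exact Real.rpow_le_rpow_of_nonpos (by positivity) hle (by linarith)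

theorem locallyFinite_support_of_eq_zero_of_norm_lt {E : Type*} [SeminormedAddCommGroup E]
    {g : ℕ → E → ℝ} (hg : ∀ (k : ℕ) y, ‖y‖ < k → g k y = 0) :
    LocallyFinite fun k => Function.support (g k) := by
  intro y
  obtain ⟨m, hm⟩ := exists_nat_gt (‖y‖)
  refine ⟨{z | ‖z‖ < m}, (isOpen_lt continuous_norm continuous_const).mem_nhds hm,
    (Set.finite_Iio m).subset ?_⟩
  rintro k ⟨z, hz1, hz2⟩
  by_contra hk
  have hmk : (m : ℝ) ≤ k := by exact_mod_cast not_lt.1 hk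
  exact hz1 (hg k z (lt_of_lt_of_le hz2 hmk))

/-- Supports escaping to infinity make the sum locally finite, hence continuous; the geometric
bounds make it integrable. -/
theorem exists_bump_series {E : Type*} [NormedAddCommGroup E] [MeasurableSpace E] [BorelSpace E]
    [SecondCountableTopology E]
    {μ : Measure E} {g : ℕ → E → ℝ} (hcont : ∀ k, Continuous (g k)) (hnn : ∀ k y, 0 ≤ g k y)
    (hzero : ∀ (k : ℕ) y, ‖y‖ < k → g k y = 0)
    (hint : ∀ k, ∫⁻ y, ENNReal.ofReal (g k y) ∂μ ≤ ENNReal.ofReal ((1 / 2) ^ k)) :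
    ∃ f : E → ℝ, Continuous f ∧ Integrable f μ ∧ (∀ y, 0 ≤ f y) ∧ ∀ k y, g k y ≤ f y := by
  have hlf := locallyFinite_support_of_eq_zero_of_norm_lt hzero
  have hsum : ∀ y, Summable fun k => g k y := fun y =>
    summable_of_hasFiniteSupport ((hlf.point_finite y).subset fun k hk => hk)
  have hcontF : Continuous fun y => ∑' k, g k y := by
    have : (fun y => ∑' k, g k y) = fun y => ∑ᶠ k, g k y := by
      ext y
      exact tsum_eq_finsum ((hlf.point_finite y).subset fun k hk => hk)
    rw [this]
    exact continuous_finsum hcont hlf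
  have hF0 : ∀ y, 0 ≤ ∑' k, g k y := fun y => tsum_nonneg fun k => hnn k y
  refine ⟨fun y => ∑' k, g k y, hcontF, ⟨hcontF.aestronglyMeasurable, ?_⟩, hF0,
    fun k y => (hsum y).le_tsum k fun j _ => hnn j y⟩
  rw [hasFiniteIntegral_iff_ofReal (Eventually.of_forall hF0)]
  calc ∫⁻ y, ENNReal.ofReal (∑' k, g k y) ∂μ
      = ∑' k, ∫⁻ y, ENNReal.ofReal (g k y) ∂μ := by
        simp_rw [ENNReal.ofReal_tsum_of_nonneg (fun k => hnn k _) (hsum _)]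
        exact lintegral_tsum fun k => (hcont k).measurable.ennreal_ofReal.aemeasurable
    _ ≤ ∑' k : ℕ, ENNReal.ofReal ((1 / 2) ^ k) := ENNReal.tsum_le_tsum hint
    _ = ENNReal.ofReal (∑' k : ℕ, (1 / 2) ^ k) :=
        (ENNReal.ofReal_tsum_of_nonneg (fun k => by positivity) summable_geometric_two).symm
    _ < ⊤ := ENNReal.ofReal_lt_top

/-- Modifications of a sequence on finite sets of indices far enough out can be glued. -/
theorem exists_glued_perturbation {c : ℕ → ℝ} (hpos : ∀ n, 0 < c n)
    {α : Type*} {P : ℕ → Finset ℕ → (ℕ → ℝ) → α → Prop}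
    (h : ∀ k N : ℕ, ∃ (W : Finset ℕ) (β : ℕ → ℝ) (g : α),
      (∀ n ∈ W, N ≤ n ∧ 0 < β n ∧ |β n / c n - 1| ≤ 1 / ((k : ℝ) + 1)) ∧ P k W β g) :
    ∃ (b : ℕ → ℝ) (W : ℕ → Finset ℕ) (β : ℕ → ℕ → ℝ) (g : ℕ → α),
      (∀ n, 0 < b n) ∧ Tendsto (fun n => b n / c n) atTop (𝓝 1) ∧
      ∀ k, P k (W k) (β k) (g k) ∧ ∀ n ∈ W k, k ≤ n ∧ b n = β k n := by
  classical
  choose W₀ β₀ g₀ hW₀ hP₀ using h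
  -- Each block starts beyond all indices of the previous one, so the blocks are disjoint.
  let N : ℕ → ℕ := fun k => Nat.rec 0 (fun k Nk => max Nk ((W₀ k Nk).sup id) + 1) k
  have hNsucc : ∀ k, N (k + 1) = max (N k) ((W₀ k (N k)).sup id) + 1 := fun k => rfl
  have hNmono : StrictMono N := strictMono_nat_of_lt_succ fun k => by rw [hNsucc]; omega
  clear_value N
  have hlow : ∀ k, ∀ n ∈ W₀ k (N k), N k ≤ n := fun k n hn => (hW₀ k _ n hn).1
  have hup : ∀ k, ∀ n ∈ W₀ k (N k), n < N (k + 1) := fun k n hn => by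
    have : n ≤ (W₀ k (N k)).sup id := Finset.le_sup (f := id) hn
    rw [hNsucc]; omega
  have huniq : ∀ k l n, n ∈ W₀ k (N k) → n ∈ W₀ l (N l) → k = l := by
    intro k l n hk hl
    have h1 := hNmono.lt_iff_lt.1 ((hlow k n hk).trans_lt (hup l n hl))
    have h2 := hNmono.lt_iff_lt.1 ((hlow l n hl).trans_lt (hup k n hk))
    omega
  let b : ℕ → ℝ := fun n => if h : ∃ k, n ∈ W₀ k (N k) then β₀ h.choose (N h.choose) n else c n
  have hb1 : ∀ k, ∀ n ∈ W₀ k (N k), b n = β₀ k (N k) n := fun k n hn => by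
    have hex : ∃ k, n ∈ W₀ k (N k) := ⟨k, hn⟩
    have : hex.choose = k := huniq _ _ n hex.choose_spec hn
    simp only [b, dif_pos hex, this]
  have hb2 : ∀ n, (¬ ∃ k, n ∈ W₀ k (N k)) → b n = c n := fun n hn => dif_neg hn
  clear_value b
  refine ⟨b, fun k => W₀ k (N k), fun k => β₀ k (N k), fun k => g₀ k (N k), fun n => ?_, ?_,
    fun k => ⟨hP₀ k _, fun n hn => ⟨(hNmono.le_apply).trans (hlow k n hn), hb1 k n hn⟩⟩⟩
  · by_cases hn : ∃ k, n ∈ W₀ k (N k)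
    · obtain ⟨k, hk⟩ := hn
      rw [hb1 k n hk]
      exact (hW₀ k _ n hk).2.1
    · rw [hb2 n hn]
      exact hpos n
  · rw [Metric.tendsto_atTop]
    intro ε hε
    obtain ⟨k₀, hk₀⟩ := exists_nat_one_div_lt hε
    refine ⟨N k₀, fun n hn => ?_⟩
    rw [Real.dist_eq]
    by_cases hex : ∃ k, n ∈ W₀ k (N k)
    · obtain ⟨k, hk⟩ := hex
      rw [hb1 k n hk]
      have hk₀k : k₀ ≤ k := Nat.lt_succ_iff.1 (hNmono.lt_iff_lt.1 (hn.trans_lt (hup k n hk)))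
      refine ((hW₀ k _ n hk).2.2.trans ?_).trans_lt hk₀
      gcongr
    · rw [hb2 n hex, div_self (hpos n).ne', sub_self, abs_zero]
      exact hε

/-! ### Conclusion -/

theorem limsup_coe_eq_top_of_frequently {u : ℕ → ℝ} (h : ∀ a, ∃ᶠ n in atTop, a ≤ u n) :
    limsup (fun n => (u n : EReal)) atTop = ⊤ := by
  rw [EReal.eq_top_iff_forall_lt]
  intro a
  have h1 : ((a + 1 : ℝ) : EReal) ≤ limsup (fun n => (u n : EReal)) atTop :=
    le_limsup_of_frequently_le ((h (a + 1)).mono fun n hn => EReal.coe_le_coe_iff.2 hn)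
  exact lt_of_lt_of_le (EReal.coe_lt_coe_iff.2 (lt_add_one a)) h1

theorem theorem4 (d : ℕ) (hd : 0 < d) (c : ℕ → ℝ) (hc : ∀ n, 0 < c n)
    -- the terms are numbered from `0`, so the term of index `n` is the `(n + 1)`-st one
    (hperm : ∀ σ : Equiv.Perm ℕ,
      ¬ BddAbove (Set.range fun n : ℕ => ((n : ℝ) + 1) ^ (1 / (d : ℝ)) / c (σ n))) :
    ∃ (b : ℕ → ℝ) (f : EuclideanSpace ℝ (Fin d) → ℝ),
      (∀ n, 0 < b n) ∧
      Tendsto (fun n => b n / c n) atTop (𝓝 1) ∧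
      Continuous f ∧
      (∀ x, 0 ≤ f x) ∧
      Integrable f volume ∧
      (∀ x, ¬ Tendsto (fun n => f (b n • x)) atTop (𝓝 0)) ∧
      (Tendsto c atTop atTop →
        ∀ x, x ≠ 0 → limsup (fun n => ((f (b n • x) : ℝ) : EReal)) atTop = ⊤) := by
  have hbase0 : ∀ x : EuclideanSpace ℝ (Fin d), 0 ≤ (1 + ‖x‖) ^ (-((d : ℝ) + 1)) := fun x => by
    positivity
  by_cases htop : Tendsto c atTop atTop
  swap
  · refine ⟨c, fun x => (1 + ‖x‖) ^ (-((d : ℝ) + 1)), hc, ?_, continuous_one_add_norm_rpow _,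
      hbase0, integrable_one_add_norm_rpow_euclidean d,
      not_tendsto_of_not_tendsto_atTop hc htop (by positivity), fun h => absurd h htop⟩
    simp only [div_self (hc _).ne', tendsto_const_nhds]
  obtain ⟨b, W, β, g, hb0, hbc, hbg⟩ := exists_glued_perturbation hc fun k N =>
    exists_perturbation_and_bump htop hd
      (fun q hq K T₀ hT₀ => exists_window htop hc hd hperm hq K hT₀)
      (ε := 1 / ((k : ℝ) + 1)) (R := k + 1) (H := k + 1) (η := (1 / 2) ^ k) (S := k)
      (by positivity) (by positivity) (by positivity) (by positivity) N
  obtain ⟨F, hFcont, hFint, hF0, hgF⟩ := exists_bump_series (fun k : ℕ => (hbg k).1.1)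
    (fun k => (hbg k).1.2.1) (fun k => (hbg k).1.2.2.1) (fun k => (hbg k).1.2.2.2.1)
  have hfreq : ∀ x : EuclideanSpace ℝ (Fin d), x ≠ 0 → ∀ a, ∃ᶠ n in atTop,
      a ≤ (1 + ‖b n • x‖) ^ (-((d : ℝ) + 1)) + F (b n • x) := by
    intro x hx a
    rw [frequently_atTop]
    intro m
    have hx0 : 0 < ‖x‖ := norm_pos_iff.2 hx
    obtain ⟨k, hk⟩ := exists_nat_ge (max (max a m) (max ‖x‖ (1 / ‖x‖)))
    have hka : a ≤ k := (le_max_left _ _).trans ((le_max_left _ _).trans hk)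
    have hkm : (m : ℝ) ≤ k := (le_max_right _ _).trans ((le_max_left _ _).trans hk)
    have hkx : ‖x‖ ≤ k := (le_max_left _ _).trans ((le_max_right _ _).trans hk)
    have hkx' : 1 / ‖x‖ ≤ k := (le_max_right _ _).trans ((le_max_right _ _).trans hk)
    obtain ⟨n, hn, hgn⟩ := (hbg k).1.2.2.2.2 x
      ((one_div_le (by positivity) hx0).2 (by linarith)) (by linarith)
    obtain ⟨hkn, hbn⟩ := (hbg k).2 n hn
    refine ⟨n, (Nat.cast_le.1 hkm).trans hkn, ?_⟩
    rw [← hbn] at hgn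
    linarith [hgF k (b n • x), hbase0 (b n • x)]
  -- The bumps never control `x = 0`; the background term, equal to `1` there, does.
  refine ⟨b, fun x => (1 + ‖x‖) ^ (-((d : ℝ) + 1)) + F x, hb0, hbc,
    (continuous_one_add_norm_rpow _).add hFcont, fun x => add_nonneg (hbase0 x) (hF0 x),
    (integrable_one_add_norm_rpow_euclidean d).add hFint, fun x hx => ?_,
    fun _ x hx => limsup_coe_eq_top_of_frequently (hfreq x hx)⟩
  have hlt := hx.eventually (gt_mem_nhds (zero_lt_one (α := ℝ)))
  by_cases hx0 : x = 0
  · obtain ⟨n, hn⟩ := hlt.exists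
    simp only [hx0, smul_zero, norm_zero, add_zero, Real.one_rpow] at hn
    linarith [hF0 0]
  · obtain ⟨n, hn1, hn2⟩ := ((hfreq x hx0 1).and_eventually hlt).exists
    exact absurd hn2 (not_lt.2 hn1)
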